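/- Let $E$ be a (real) Banach lattice and let $p \ge 1$ be a real number. A sequence $(x_n)_n$ in $E$ is called disjoint if $|x_m| \wedge |x_n| = 0$ whenever $m \neq n$, and weakly $p$-summable if $\sum_n |x^*(x_n)|^p < \infty$ for every $x^*$ in the topological dual $E^*$. Then the following are equivalent: (1) $E$ has the positive Schur property of order $p$ ($SP_p^+$), that is, every disjoint weakly $p$-summable sequence in $E$ converges to $0$ in norm. (2) $E$ has order continuous norm (that is, $\inf\{\|x\| : x \in A\} = 0$ for every nonempty downwards directed set $A \subseteq E$ with $\inf A = 0$) and $E$ has the disjoint Dunford-Pettis$^*$ property of order $p$ (disjoint $DP^*P_p$), that is, for every disjoint weakly $p$-summable sequence $(x_n)_n$ in $E$ the set $\{x_n : n \in \mathbb{N}\}$ is limited, which means that every weak$^*$ null sequence $(x_k^*)_k$ in $E^*$ satisfies $\sup_{n} |x_k^*(x_n)| \to 0$ as $k \to \infty$. -/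

import Mathlib

open Filter Topology

/-- A sequence in a lattice-ordered group is disjoint if its terms with distinct indices are
disjoint: `|x m| ⊓ |x n| = 0` for `m ≠ n`. -/
def IsDisjointSeq {E : Type*} [AddCommGroup E] [Lattice E] (x : ℕ → E) : Prop :=
  Pairwise fun m n => |x m| ⊓ |x n| = 0

/-- A sequence in a normed space is weakly `p`-summable if `∑ |f (x n)| ^ p < ∞` for every
bounded linear functional `f`. -/
def IsWeaklyPSummable {E : Type*} [NormedAddCommGroup E] [NormedSpace ℝ E]
    (p : ℝ) (x : ℕ → E) : Prop :=
  ∀ f : StrongDual ℝ E, Summable fun n => |f (x n)| ^ p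

/-- A set is limited if every weak* null sequence in the dual converges to zero uniformly
on it. -/
def IsLimitedSet {E : Type*} [NormedAddCommGroup E] [NormedSpace ℝ E] (A : Set E) : Prop :=
  ∀ f : ℕ → WeakDual ℝ E, Tendsto f atTop (𝓝 0) →
    TendstoUniformlyOn (fun n x => f n x) (fun _ => (0 : ℝ)) atTop A

/-- The norm is order continuous if `inf {‖x‖ : x ∈ A} = 0` for every nonempty
downwards directed set `A` with infimum `0`. -/
def HasOrderContinuousNorm (E : Type*) [NormedAddCommGroup E] [Lattice E] : Prop :=
  ∀ A : Set E, A.Nonempty → DirectedOn (fun a b => b ≤ a) A → IsGLB A 0 →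
    IsGLB ((fun x => ‖x‖) '' A) (0 : ℝ)

/-- The positive Schur property of order `p`: disjoint weakly `p`-summable sequences are norm
null, that is, the identity operator is disjoint `p`-convergent. -/
def HasPositiveSchurProperty (p : ℝ) (E : Type*) [NormedAddCommGroup E] [NormedSpace ℝ E]
    [Lattice E] : Prop :=
  ∀ x : ℕ → E, IsDisjointSeq x → IsWeaklyPSummable p x → Tendsto x atTop (𝓝 0)

/-- The disjoint Dunford-Pettis* property of order `p`: the set of terms of every disjoint
weakly `p`-summable sequence is limited. -/
def HasDisjointDPStarProperty (p : ℝ) (E : Type*) [NormedAddCommGroup E] [NormedSpace ℝ E]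
    [Lattice E] : Prop :=
  ∀ x : ℕ → E, IsDisjointSeq x → IsWeaklyPSummable p x → IsLimitedSet (Set.range x)

/-!
Both directions pass through the property that order bounded disjoint sequences are norm null, which
is equivalent to order continuity of the norm.

* If the norm is order continuous, a monotone sequence with range `S` and an upper bound is Cauchy,
  since the set of differences of upper bounds and elements of `S` is directed downwards to `0`. The
  partial sums of `|w n|` are such a sequence when `w` is disjoint and order bounded.
* Conversely, an increment of a monotone sequence in `[0, N • w]` is at most `2 • w` plus twice its
  crossings of the levels `0, w, …, N • w`. The crossings of one level are disjoint, hence norm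
  null, so decreasing positive sequences have norm null increments and decreasing positive nets
  converge.

Order bounded disjoint sequences are weakly `1`-summable, so the positive Schur property makes them
norm null. In the other direction, norm each term of a disjoint sequence `x` by a functional
dominated by the norm of the component in the band generated by `x n`. These functionals are weak*
null, as the components of a fixed element are order bounded and disjoint, and limitedness of `x`
then gives `‖x n‖ → 0`.
-/

section Disjointness

variable {E : Type*} [Lattice E]

theorem inf_eq_zero_of_le [Zero E] {a b c d : E} (hc : 0 ≤ c) (hd : 0 ≤ d) (hca : c ≤ a)
    (hdb : d ≤ b) (hab : a ⊓ b = 0) : c ⊓ d = 0 :=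
  le_antisymm (hab ▸ inf_le_inf hca hdb) (le_inf hc hd)

variable [AddCommGroup E] [IsOrderedAddMonoid E]

theorem inf_add_le_inf_add_inf {a b c : E} (ha : 0 ≤ a) (hb : 0 ≤ b) (hc : 0 ≤ c) :
    a ⊓ (b + c) ≤ a ⊓ b + a ⊓ c := by
  rw [inf_add, add_inf, add_inf]
  exact le_inf (le_inf (inf_le_left.trans (le_add_of_nonneg_right ha))
    (inf_le_left.trans (le_add_of_nonneg_right hc)))
    (le_inf (inf_le_left.trans (le_add_of_nonneg_left hb)) inf_le_right)

theorem inf_sum_eq_zero {ι : Type*} {s : Finset ι} {a : E} {v : ι → E} (ha : 0 ≤ a)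
    (hv : ∀ i ∈ s, 0 ≤ v i) (h : ∀ i ∈ s, a ⊓ v i = 0) : a ⊓ ∑ i ∈ s, v i = 0 := by
  classical
  induction s using Finset.induction_on with
  | empty => simpa using ha
  | insert j s hj ih =>
    rw [Finset.forall_mem_insert] at hv h
    have hs : 0 ≤ ∑ i ∈ s, v i := Finset.sum_nonneg hv.2
    rw [Finset.sum_insert hj]
    refine le_antisymm ((inf_add_le_inf_add_inf ha hv.1 hs).trans_eq ?_)
      (le_inf ha (add_nonneg hv.1 hs))
    rw [h.1, ih hv.2 h.2, add_zero]

theorem inf_nsmul_eq_zero {a b : E} (ha : 0 ≤ a) (hb : 0 ≤ b) (h : a ⊓ b = 0) (k : ℕ) :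
    a ⊓ k • b = 0 := by
  simpa using inf_sum_eq_zero (s := Finset.range k) ha (fun _ _ => hb) fun _ _ => h

theorem IsDisjointSeq.of_abs_le_nsmul_abs {x w : ℕ → E} (hx : IsDisjointSeq x) {k : ℕ → ℕ}
    (hw : ∀ n, |w n| ≤ k n • |x n|) : IsDisjointSeq w := fun m n hmn => by
  refine inf_eq_zero_of_le (abs_nonneg _) (abs_nonneg _) (hw m) (hw n)
    (inf_nsmul_eq_zero (nsmul_nonneg (abs_nonneg _) _) (abs_nonneg _) ?_ _)
  rw [inf_comm]
  exact inf_nsmul_eq_zero (abs_nonneg _) (abs_nonneg _) (hx hmn.symm) _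

theorem IsDisjointSeq.sum_abs_le {w : ℕ → E} (hw : IsDisjointSeq w) {x : E}
    (hwx : ∀ n, |w n| ≤ x) (s : Finset ℕ) : ∑ n ∈ s, |w n| ≤ x := by
  induction s using Finset.induction_on with
  | empty => simpa using (abs_nonneg _).trans (hwx 0)
  | insert j s hj ih =>
    have hdisj : |w j| ⊓ ∑ n ∈ s, |w n| = 0 :=
      inf_sum_eq_zero (abs_nonneg _) (fun _ _ => abs_nonneg _)
        fun n hn => hw (ne_of_mem_of_not_mem hn hj).symm
    rw [Finset.sum_insert hj, ← inf_add_sup, hdisj, zero_add]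
    exact sup_le (hwx j) ih

end Disjointness

section Crossing

variable {E : Type*} [Lattice E] [AddCommGroup E]

/-- The amount by which an increase from `a` to `b` straddles the level `c`. In `ℝ` it is positive
exactly when `a < c < b`. The successive crossings of a level by a monotone sequence are
disjoint. -/
def crossing (a b c : E) : E := ((b - c) ⊓ (c - a))⁺

theorem crossing_nonneg (a b c : E) : 0 ≤ crossing a b c := posPart_nonneg _

variable [IsOrderedAddMonoid E]

theorem crossing_le (a : E) {b c : E} (hb : 0 ≤ b) (hc : 0 ≤ c) : crossing a b c ≤ b :=
  sup_le (inf_le_left.trans (sub_le_self b hc)) hb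

theorem crossing_inf_crossing_eq_zero {a b a' b' : E} (h : b ≤ a') (c : E) :
    crossing a b c ⊓ crossing a' b' c = 0 := by
  refine inf_eq_zero_of_le (crossing_nonneg _ _ _) (crossing_nonneg _ _ _)
    (posPart_mono (inf_le_left.trans (sub_le_sub_right h c))) (posPart_mono inf_le_right) ?_
  beta_reduce
  rw [← neg_sub a' c, posPart_neg, posPart_inf_negPart_eq_zero]

theorem sub_le_abs_add_two_nsmul_crossing (a b c : E) :
    b - a ≤ |a + b - 2 • c| + 2 • crossing a b c := by
  have hinf : 2 • ((b - c) ⊓ (c - a)) = b - a - |a + b - 2 • c| := by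
    rw [two_nsmul_inf_eq_add_sub_abs_sub, sub_add_sub_cancel, ← abs_neg (c - a - (b - c))]
    congr 2
    abel
  calc b - a = |a + b - 2 • c| + 2 • ((b - c) ⊓ (c - a)) := by rw [hinf]; abel
    _ ≤ |a + b - 2 • c| + 2 • crossing a b c := by gcongr; exact le_posPart _

theorem sup_inf_abs_sub_le {v : E} (hv : 0 ≤ v) (s : E) : (v ⊔ s) ⊓ |s - v| ≤ v ⊔ (s - v) := by
  have hdisj : (s - v)⁺ ⊓ (v ⊓ (s - v)⁻) = 0 :=
    inf_eq_zero_of_le (posPart_nonneg _) (le_inf hv (negPart_nonneg _)) le_rfl inf_le_right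
      (posPart_inf_negPart_eq_zero _)
  calc (v ⊔ s) ⊓ |s - v| = (s - v)⁺ + v ⊓ (s - v)⁻ := by
        rw [add_inf, posPart_add_negPart, posPart_def, sup_add, sub_add_cancel, zero_add, sup_comm]
    _ = (s - v)⁺ ⊔ v ⊓ (s - v)⁻ := by rw [← inf_add_sup, hdisj, zero_add]
    _ ≤ v ⊔ (s - v) := sup_le (sup_le le_sup_right (hv.trans le_sup_left))
        (inf_le_left.trans le_sup_left)

theorem sub_le_sup_add_sum_crossing {a b w : E} (hab : 0 ≤ a + b) (hw : 0 ≤ w) (k : ℕ) :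
    b - a ≤ (2 • w ⊔ (a + b - 2 • k • w)) +
      2 • ∑ i ∈ Finset.range (k + 1), crossing a b (i • w) := by
  -- Each level `c` gives the bound `|a + b - 2 • c| + 2 • crossing a b c`, which is good when `c`
  -- is close to the midpoint of `a` and `b`; the induction takes the infimum over the levels.
  induction k with
  | zero =>
    calc b - a ≤ |a + b| + 2 • crossing a b 0 := by
          simpa using sub_le_abs_add_two_nsmul_crossing a b 0
      _ = a + b + 2 • crossing a b 0 := by rw [abs_of_nonneg hab]
      _ ≤ _ := by simp
  | succ k ih =>
    have hlevel := sub_le_abs_add_two_nsmul_crossing a b ((k + 1) • w)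
    have hshift : a + b - 2 • (k + 1) • w = a + b - 2 • k • w - 2 • w := by
      rw [succ_nsmul w k, nsmul_add, sub_add_eq_sub_sub]
    rw [hshift] at hlevel ⊢
    set σ := 2 • ∑ i ∈ Finset.range (k + 1 + 1), crossing a b (i • w) with hσ
    rw [Finset.sum_range_succ, nsmul_add] at hσ
    have hsum : 2 • ∑ i ∈ Finset.range (k + 1), crossing a b (i • w) ≤ σ :=
      hσ ▸ le_add_of_nonneg_right (nsmul_nonneg (crossing_nonneg _ _ _) 2)
    have hlast : 2 • crossing a b ((k + 1) • w) ≤ σ :=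
      hσ ▸ le_add_of_nonneg_left
        (nsmul_nonneg (Finset.sum_nonneg fun _ _ => crossing_nonneg _ _ _) 2)
    calc b - a
        ≤ (2 • w ⊔ (a + b - 2 • k • w)) ⊓ |a + b - 2 • k • w - 2 • w| + σ := by
          rw [inf_add]
          exact le_inf (ih.trans (by gcongr)) (hlevel.trans (by gcongr))
      _ ≤ 2 • w ⊔ (a + b - 2 • k • w - 2 • w) + σ := by
          gcongr
          exact sup_inf_abs_sub_le (nsmul_nonneg hw 2) _

theorem sub_le_two_nsmul_add_sum_crossing {a b w : E} (hab : 0 ≤ a + b) (hw : 0 ≤ w) {k : ℕ}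
    (ha : a ≤ k • w) (hb : b ≤ k • w) :
    b - a ≤ 2 • (w + ∑ i ∈ Finset.range (k + 1), crossing a b (i • w)) := by
  have h0 : a + b - 2 • k • w ≤ 0 := by rw [two_nsmul, sub_nonpos]; exact add_le_add ha hb
  have h := sub_le_sup_add_sum_crossing hab hw k
  rwa [sup_eq_left.2 (h0.trans (nsmul_nonneg hw 2)), ← nsmul_add] at h

end Crossing

section OrderContinuousNorm

open scoped Pointwise

theorem nonpos_of_forall_nsmul_le {E : Type*} [AddCommGroup E] [Module ℝ E] [TopologicalSpace E]
    [ContinuousSMul ℝ E] [PartialOrder E] [PosSMulMono ℝ E] [ClosedIciTopology E] {b z : E}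
    (h : ∀ n : ℕ, n • b ≤ z) : b ≤ 0 := by
  have hlim : Tendsto (fun n : ℕ => (n : ℝ)⁻¹ • z) atTop (𝓝 0) := by
    simpa using tendsto_inv_atTop_nhds_zero_nat (𝕜 := ℝ).smul_const z
  refine ge_of_tendsto hlim ?_
  filter_upwards [eventually_gt_atTop 0] with n hn
  rw [le_inv_smul_iff_of_pos (Nat.cast_pos.2 hn), Nat.cast_smul_eq_nsmul]
  exact h n

theorem isGLB_upperBounds_sub {E : Type*} [AddCommGroup E] [Module ℝ E] [TopologicalSpace E]
    [ContinuousSMul ℝ E] [PartialOrder E] [IsOrderedAddMonoid E] [PosSMulMono ℝ E]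
    [ClosedIciTopology E] {S : Set E} (hne : S.Nonempty) (hbdd : BddAbove S) :
    IsGLB (upperBounds S - S) 0 := by
  refine ⟨?_, fun b hb => ?_⟩
  · rintro _ ⟨z, hz, s, hs, rfl⟩
    exact sub_nonneg.2 (hz hs)
  obtain ⟨z, hz⟩ := hbdd
  have hsub : ∀ n : ℕ, z - n • b ∈ upperBounds S := fun n => by
    induction n with
    | zero => simpa using hz
    | succ n ih =>
      intro s hs
      rw [succ_nsmul, sub_add_eq_sub_sub, le_sub_comm]
      exact hb (Set.sub_mem_sub ih hs)
  obtain ⟨s, hs⟩ := hne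
  exact nonpos_of_forall_nsmul_le fun n => le_sub_comm.1 (hsub n hs)

theorem norm_le_norm_of_nonneg_of_le {E : Type*} [NormedAddCommGroup E] [Lattice E]
    [IsOrderedAddMonoid E] [HasSolidNorm E] {a b : E} (ha : 0 ≤ a) (hab : a ≤ b) : ‖a‖ ≤ ‖b‖ :=
  norm_le_norm_of_abs_le_abs (by rwa [abs_of_nonneg ha, abs_of_nonneg (ha.trans hab)])

/-- Every order bounded disjoint sequence is norm null. For Banach lattices this is equivalent to
order continuity of the norm. -/
def HasNullOrderBoundedDisjointSeqs (E : Type*) [NormedAddCommGroup E] [Lattice E] : Prop :=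
  ∀ (w : ℕ → E) (x : E), IsDisjointSeq w → (∀ n, |w n| ≤ x) → Tendsto w atTop (𝓝 0)

variable {E : Type*} [NormedAddCommGroup E] [Lattice E] [IsOrderedAddMonoid E]

theorem HasNullOrderBoundedDisjointSeqs.tendsto_crossing (hE : HasNullOrderBoundedDisjointSeqs E)
    {f : ℕ → E} (hf : Antitone f) (hf0 : ∀ n, 0 ≤ f n) {c : E} (hc : 0 ≤ c) :
    Tendsto (fun n => crossing (f (n + 1)) (f n) c) atTop (𝓝 0) := by
  refine hE _ (f 0) (fun m n hmn => ?_) fun n => ?_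
  · simp only [abs_of_nonneg (crossing_nonneg _ _ _)]
    rcases hmn.lt_or_gt with h | h
    · rw [inf_comm]
      exact crossing_inf_crossing_eq_zero (hf h) c
    · exact crossing_inf_crossing_eq_zero (hf h) c
  · rw [abs_of_nonneg (crossing_nonneg _ _ _)]
    exact (crossing_le _ (hf0 n) hc).trans (hf n.zero_le)

variable [NormedSpace ℝ E] [IsOrderedModule ℝ E] [HasSolidNorm E]

theorem HasOrderContinuousNorm.cauchySeq_of_monotone (hE : HasOrderContinuousNorm E) {ι : Type*}
    [SemilatticeSup ι] [Nonempty ι] {s : ι → E} (hs : Monotone s)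
    (hbdd : BddAbove (Set.range s)) : CauchySeq s := by
  have hdir : DirectedOn (fun a b => b ≤ a) (upperBounds (Set.range s) - Set.range s) := by
    rintro _ ⟨z, hz, _, ⟨m, rfl⟩, rfl⟩ _ ⟨z', hz', _, ⟨n, rfl⟩, rfl⟩
    exact ⟨z ⊓ z' - s (m ⊔ n),
      Set.sub_mem_sub (fun y hy => le_inf (hz hy) (hz' hy)) (Set.mem_range_self _),
      sub_le_sub inf_le_left (hs le_sup_left), sub_le_sub inf_le_right (hs le_sup_right)⟩
  have hglb := hE _ (hbdd.sub (Set.range_nonempty s)) hdir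
    (isGLB_upperBounds_sub (Set.range_nonempty s) hbdd)
  rw [Metric.cauchySeq_iff']
  intro ε hε
  obtain ⟨_, ⟨_, ⟨z, hz, _, ⟨N, rfl⟩, rfl⟩, rfl⟩, -, hlt⟩ := hglb.exists_between hε
  refine ⟨N, fun n hn => ?_⟩
  rw [dist_eq_norm]
  exact (norm_le_norm_of_nonneg_of_le (sub_nonneg.2 (hs hn))
    (sub_le_sub_right (hz ⟨n, rfl⟩) _)).trans_lt hlt

theorem HasOrderContinuousNorm.hasNullOrderBoundedDisjointSeqs (hE : HasOrderContinuousNorm E) :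
    HasNullOrderBoundedDisjointSeqs E := by
  intro w x hw hwx
  set s : ℕ → E := fun n => ∑ i ∈ Finset.range n, |w i|
  have hmono : Monotone s := monotone_nat_of_le_succ fun n => by
    simpa only [s, Finset.sum_range_succ] using le_add_of_nonneg_right (abs_nonneg (w n))
  have hbdd : BddAbove (Set.range s) := ⟨x, by
    rintro _ ⟨n, rfl⟩
    exact hw.sum_abs_le hwx _⟩
  have hincr : Tendsto (fun n => dist (s (n + 1)) (s n)) atTop (𝓝 0) := by
    refine (cauchySeq_iff_tendsto_dist_atTop_0.1 (hE.cauchySeq_of_monotone hmono hbdd)).comp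
      (g := fun m : ℕ × ℕ => dist (s m.1) (s m.2)) (f := fun n => (n + 1, n)) ?_
    rw [← prod_atTop_atTop_eq]
    exact (tendsto_add_atTop_nat 1).prodMk tendsto_id
  rw [tendsto_zero_iff_norm_tendsto_zero]
  simpa only [s, dist_eq_norm, Finset.sum_range_succ_sub_sum, norm_abs_eq_norm] using hincr

namespace HasNullOrderBoundedDisjointSeqs

theorem tendsto_sub_of_antitone (hE : HasNullOrderBoundedDisjointSeqs E) {f : ℕ → E}
    (hf : Antitone f) (hf0 : ∀ n, 0 ≤ f n) :
    Tendsto (fun n => f n - f (n + 1)) atTop (𝓝 0) := by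
  rw [tendsto_zero_iff_norm_tendsto_zero, tendsto_order]
  refine ⟨fun r hr => .of_forall fun n => hr.trans_le (norm_nonneg _), fun ε hε => ?_⟩
  obtain ⟨N, hN, hNε⟩ : ∃ N : ℕ, 0 < N ∧ ‖2 • (N : ℝ)⁻¹ • f 0‖ < ε := by
    have hlim : Tendsto (fun N : ℕ => 2 • (N : ℝ)⁻¹ • f 0) atTop (𝓝 0) := by
      simpa using (tendsto_inv_atTop_nhds_zero_nat (𝕜 := ℝ).smul_const (f 0)).const_smul (2 : ℕ)
    exact ((eventually_gt_atTop 0).and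
      (hlim.norm.eventually_lt_const (by simpa using hε))).exists
  set w := (N : ℝ)⁻¹ • f 0 with hw
  have hw0 : 0 ≤ w := smul_nonneg (by positivity) (hf0 0)
  have hfw : ∀ n, f n ≤ N • w := fun n => by
    rw [hw, ← Nat.cast_smul_eq_nsmul ℝ, smul_inv_smul₀ (by positivity)]
    exact hf n.zero_le
  have hlim : Tendsto (fun n => 2 • (w + ∑ i ∈ Finset.range (N + 1),
      crossing (f (n + 1)) (f n) (i • w))) atTop (𝓝 (2 • w)) := by
    simpa only [Finset.sum_const_zero, add_zero] using
      (tendsto_const_nhds.add (tendsto_finsetSum _ fun i _ =>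
        hE.tendsto_crossing hf hf0 (nsmul_nonneg hw0 i))).const_smul (2 : ℕ)
  filter_upwards [hlim.norm.eventually_lt_const hNε] with n hn
  exact (norm_le_norm_of_nonneg_of_le (sub_nonneg.2 (hf n.le_succ))
    (sub_le_two_nsmul_add_sum_crossing (add_nonneg (hf0 _) (hf0 n)) hw0 (hfw _) (hfw n))).trans_lt
    hn

theorem exists_forall_norm_sub_lt (hE : HasNullOrderBoundedDisjointSeqs E) {ι : Type*}
    [Preorder ι] [Nonempty ι] {f : ι → E} (hf : Monotone f) (hf0 : ∀ i, 0 ≤ f i) {ε : ℝ}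
    (hε : 0 < ε) : ∃ i, ∀ j ≤ i, ‖f i - f j‖ < ε := by
  by_contra! h
  choose g hg_le hg using h
  let i₀ := Classical.arbitrary ι
  have hanti : Antitone fun n => f (g^[n] i₀) := antitone_nat_of_succ_le fun n => by
    rw [Function.iterate_succ_apply']
    exact hf (hg_le _)
  obtain ⟨n, hn⟩ := ((hE.tendsto_sub_of_antitone hanti fun n => hf0 _).norm.eventually_lt_const
    (by simpa using hε)).exists
  rw [Function.iterate_succ_apply'] at hn
  exact (hg _).not_gt hn

theorem cauchy_map_atBot (hE : HasNullOrderBoundedDisjointSeqs E) {ι : Type*} [Preorder ι]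
    [Nonempty ι] [IsCodirectedOrder ι] {f : ι → E} (hf : Monotone f) (hf0 : ∀ i, 0 ≤ f i) :
    Cauchy (map f atBot) := by
  rw [Metric.cauchy_iff]
  refine ⟨inferInstance, fun ε hε => ?_⟩
  obtain ⟨i, hi⟩ := hE.exists_forall_norm_sub_lt hf hf0 (half_pos hε)
  refine ⟨f '' Set.Iic i, image_mem_map (Iic_mem_atBot i), ?_⟩
  rintro _ ⟨j, hj, rfl⟩ _ ⟨k, hk, rfl⟩
  calc dist (f j) (f k) ≤ dist (f i) (f j) + dist (f i) (f k) := dist_triangle_left _ _ _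
    _ < ε / 2 + ε / 2 := by
      rw [dist_eq_norm, dist_eq_norm]
      exact add_lt_add (hi j hj) (hi k hk)
    _ = ε := add_halves ε

theorem hasOrderContinuousNorm [CompleteSpace E] (hE : HasNullOrderBoundedDisjointSeqs E) :
    HasOrderContinuousNorm E := by
  intro A hne hdir hglb
  have : Nonempty A := hne.to_subtype
  have : IsCodirectedOrder A := ⟨fun a b => by
    obtain ⟨c, hc, hca, hcb⟩ := hdir a a.2 b b.2
    exact ⟨⟨c, hc⟩, hca, hcb⟩⟩
  have hmono : Monotone ((↑) : A → E) := Subtype.mono_coe A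
  have hnonneg : ∀ a : A, (0 : E) ≤ a := fun a => hglb.1 a.2
  obtain ⟨l, hl⟩ := CompleteSpace.complete (hE.cauchy_map_atBot hmono hnonneg)
  have hl0 : l = 0 := (isGLB_of_tendsto_atBot hmono hl).unique (by rwa [Subtype.range_coe])
  have hnorm : Monotone fun a : A => ‖(a : E)‖ := fun a b hab =>
    norm_le_norm_of_nonneg_of_le (hnonneg a) hab
  have hlim : Tendsto (fun a : A => ‖(a : E)‖) atBot (𝓝 0) := by
    simpa [hl0] using (show Tendsto ((↑) : A → E) atBot (𝓝 l) from hl).norm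
  rw [Set.image_eq_range]
  exact isGLB_of_tendsto_atBot hnorm hlim

end HasNullOrderBoundedDisjointSeqs

end OrderContinuousNorm

section WeakSummability

theorem IsWeaklyPSummable.of_exponent_le {E : Type*} [NormedAddCommGroup E] [NormedSpace ℝ E]
    {p q : ℝ} (hp : 0 < p) (hpq : p ≤ q) {x : ℕ → E} (hx : IsWeaklyPSummable p x) :
    IsWeaklyPSummable q x := by
  intro f
  refine Summable.of_norm_bounded_eventually_nat (hx f) ?_
  filter_upwards [(hx f).tendsto_atTop_zero.eventually_le_const one_pos] with n hn
  have hle_one : |f (x n)| ≤ 1 := le_of_not_gt fun h => hn.not_gt (Real.one_lt_rpow h hp)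
  rw [Real.norm_of_nonneg (by positivity)]
  exact Real.rpow_le_rpow_of_exponent_ge' (abs_nonneg _) hle_one hp.le hpq

variable {E : Type*} [NormedAddCommGroup E] [NormedSpace ℝ E] [Lattice E] [IsOrderedAddMonoid E]
  [HasSolidNorm E]

theorem IsDisjointSeq.isWeaklyPSummable_one {w : ℕ → E} (hw : IsDisjointSeq w) {x : E}
    (hwx : ∀ n, |w n| ≤ x) : IsWeaklyPSummable 1 w := by
  intro f
  simp only [Real.rpow_one]
  refine summable_of_sum_le (c := ‖f‖ * ‖x‖) (fun _ => abs_nonneg _) fun s => ?_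
  -- Changing the signs of the terms of `w` turns the sum of moduli into one value of `f`.
  set v : ℕ → E := fun n => if 0 ≤ f (w n) then w n else -w n
  have hfv : ∀ n, |f (w n)| = f (v n) := fun n => by
    by_cases h : 0 ≤ f (w n)
    · simp only [v, if_pos h, abs_of_nonneg h]
    · simp only [v, if_neg h, map_neg, abs_of_neg (not_le.1 h)]
  have hv : ∀ n, |v n| = |w n| := fun n => by simp only [v, abs_ite, abs_neg, ite_self]
  have hsum : |∑ n ∈ s, v n| ≤ |x| :=
    calc |∑ n ∈ s, v n| ≤ ∑ n ∈ s, |v n| :=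
          Finset.le_sum_of_subadditive _ abs_zero.le abs_add_le _ _
      _ = ∑ n ∈ s, |w n| := by simp only [hv]
      _ ≤ |x| := (hw.sum_abs_le hwx s).trans (le_abs_self x)
  calc ∑ n ∈ s, |f (w n)| = f (∑ n ∈ s, v n) := by simp only [hfv, map_sum]
    _ ≤ ‖f‖ * ‖∑ n ∈ s, v n‖ := (le_abs_self _).trans (f.le_opNorm _)
    _ ≤ ‖f‖ * ‖x‖ := by gcongr; exact norm_le_norm_of_abs_le_abs hsum

theorem HasPositiveSchurProperty.hasNullOrderBoundedDisjointSeqs {p : ℝ} (hp : 1 ≤ p)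
    (hE : HasPositiveSchurProperty p E) : HasNullOrderBoundedDisjointSeqs E := fun w _ hw hwx =>
  hE w hw ((hw.isWeaklyPSummable_one hwx).of_exponent_le one_pos hp)

end WeakSummability

section LimitedSets

variable {E : Type*} [NormedAddCommGroup E] [NormedSpace ℝ E]

theorem IsLimitedSet.mono {A B : Set E} (hB : IsLimitedSet B) (hAB : A ⊆ B) : IsLimitedSet A :=
  fun f hf => (hB f hf).mono hAB

theorem isLimitedSet_of_isCompact [CompleteSpace E] {K : Set E} (hK : IsCompact K) :
    IsLimitedSet K := by
  intro f hf
  have hpt : ∀ y, Tendsto (fun n => f n y) atTop (𝓝 0) :=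
    tendsto_iff_forall_eval_tendsto_topDualPairing.1 hf
  have hequi : UniformEquicontinuous fun n => (f n : E → ℝ) :=
    PolynormableSpace.banach_steinhaus (𝓕 := fun n => WeakDual.toStrongDual (f n))
      fun y => (hpt y).isVonNBounded_range ℝ
  have hunif := (EquicontinuousOn.tendsto_uniformOnFun_iff_pi' (𝔖 := {K}) (by simpa)
    (fun _ _ => hequi.equicontinuous.equicontinuousOn _) atTop fun _ => (0 : ℝ)).2
    (tendsto_pi_nhds.2 fun y => hpt y)
  exact UniformOnFun.tendsto_iff_tendstoUniformlyOn.1 hunif K rfl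

theorem isLimitedSet_range_of_tendsto [CompleteSpace E] {x : ℕ → E} {l : E}
    (hx : Tendsto x atTop (𝓝 l)) : IsLimitedSet (Set.range x) :=
  (isLimitedSet_of_isCompact hx.isCompact_insert_range).mono (Set.subset_insert _ _)

end LimitedSets

section BandSeminorm

theorem exists_strongDual_eq_seminorm {𝕜 E : Type*} [RCLike 𝕜] [AddCommGroup E]
    [TopologicalSpace E] [Module 𝕜 E] [PolynormableSpace 𝕜 E] {p : Seminorm 𝕜 E}
    (hp : Continuous p) (x : E) : ∃ g : StrongDual 𝕜 E, g x = p x ∧ ∀ y, ‖g y‖ ≤ p y := by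
  rcases eq_or_ne x 0 with rfl | hx
  · exact ⟨0, by simp, fun y => by simp⟩
  let c : (𝕜 ∙ x) →ₗ[𝕜] 𝕜 := LinearEquiv.coord 𝕜 E x hx
  have hle : ∀ y, ‖((p x : 𝕜) • c) y‖ ≤ p y := fun y => by
    refine le_of_eq ?_
    calc ‖((p x : 𝕜) • c) y‖ = ‖c y‖ * p x := by
          rw [LinearMap.smul_apply, norm_smul, RCLike.norm_ofReal,
            abs_of_nonneg (apply_nonneg p x), mul_comm]
      _ = p (c y • x) := (map_smul_eq_mul p _ _).symm
      _ = p y := congrArg p (LinearEquiv.coord_apply_smul 𝕜 E x hx y)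
  obtain ⟨g, hg, hgp⟩ := Module.Dual.exists_continuous_extension_of_le_seminorm _ _ hp hle
  have hcx : c ⟨x, Submodule.mem_span_singleton_self x⟩ = 1 := LinearEquiv.coord_self 𝕜 E x hx
  refine ⟨g, (hg ⟨x, Submodule.mem_span_singleton_self x⟩).trans ?_, hgp⟩
  rw [LinearMap.smul_apply, hcx, smul_eq_mul, mul_one]

theorem abs_smul_le {R E : Type*} [Ring R] [LinearOrder R] [IsOrderedRing R] [AddCommGroup E]
    [Lattice E] [IsOrderedAddMonoid E] [Module R E] [PosSMulMono R E] (r : R) (y : E) :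
    |r • y| ≤ |r| • |y| := by
  rcases le_total 0 r with hr | hr
  · rw [abs_of_nonneg hr, abs_le', ← smul_neg]
    exact ⟨smul_le_smul_of_nonneg_left (le_abs_self y) hr,
      smul_le_smul_of_nonneg_left (neg_le_abs y) hr⟩
  · rw [abs_of_nonpos hr, abs_le', ← neg_smul, ← neg_smul_neg r y]
    exact ⟨smul_le_smul_of_nonneg_left (neg_le_abs y) (neg_nonneg.2 hr),
      smul_le_smul_of_nonneg_left (le_abs_self y) (neg_nonneg.2 hr)⟩

variable {E : Type*} [NormedAddCommGroup E] [Lattice E] [IsOrderedAddMonoid E] [HasSolidNorm E]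

theorem norm_abs_inf_nsmul_abs_le (u y : E) (k : ℕ) : ‖|y| ⊓ k • |u|‖ ≤ ‖y‖ :=
  (norm_le_norm_of_nonneg_of_le (le_inf (abs_nonneg y) (nsmul_nonneg (abs_nonneg u) k))
    inf_le_left).trans_eq (norm_abs_eq_norm y)

theorem bddAbove_range_norm_abs_inf_nsmul_abs (u y : E) :
    BddAbove (Set.range fun k : ℕ => ‖|y| ⊓ k • |u|‖) :=
  ⟨‖y‖, Set.forall_mem_range.2 (norm_abs_inf_nsmul_abs_le u y)⟩

theorem norm_abs_add_inf_le {u : E} (hu : 0 ≤ u) (y z : E) :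
    ‖|y + z| ⊓ u‖ ≤ ‖|y| ⊓ u‖ + ‖|z| ⊓ u‖ := by
  refine (norm_le_norm_of_nonneg_of_le (le_inf (abs_nonneg _) hu) ?_).trans (norm_add_le _ _)
  calc |y + z| ⊓ u ≤ u ⊓ (|y| + |z|) := by rw [inf_comm]; gcongr; exact abs_add_le y z
    _ ≤ u ⊓ |y| + u ⊓ |z| := inf_add_le_inf_add_inf hu (abs_nonneg y) (abs_nonneg z)
    _ = |y| ⊓ u + |z| ⊓ u := by rw [inf_comm, inf_comm u]

variable [NormedSpace ℝ E] [IsOrderedModule ℝ E]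

theorem exists_norm_abs_smul_inf_nsmul_le (u : E) {r : ℝ} (hr : r ≠ 0) (y : E) (k : ℕ) :
    ∃ m : ℕ, ‖|r • y| ⊓ k • |u|‖ ≤ ‖r‖ * ‖|y| ⊓ m • |u|‖ := by
  have hr' : 0 < |r| := abs_pos.2 hr
  obtain ⟨m, hm⟩ := exists_nat_ge (k / |r|)
  rw [div_le_iff₀' hr'] at hm
  have hk : k • |u| ≤ |r| • m • |u| := by
    rw [← Nat.cast_smul_eq_nsmul ℝ, ← Nat.cast_smul_eq_nsmul ℝ, smul_smul]
    exact smul_le_smul_of_nonneg_right hm (abs_nonneg u)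
  refine ⟨m, ?_⟩
  calc ‖|r • y| ⊓ k • |u|‖ ≤ ‖|r| • |y| ⊓ |r| • m • |u|‖ :=
        norm_le_norm_of_nonneg_of_le (le_inf (abs_nonneg _) (nsmul_nonneg (abs_nonneg u) k))
          (inf_le_inf (abs_smul_le r y) hk)
    _ = ‖|r| • (|y| ⊓ m • |u|)‖ :=
        congrArg _ ((OrderIso.smulRight (β := E) hr').map_inf _ _).symm
    _ = ‖r‖ * ‖|y| ⊓ m • |u|‖ := by rw [norm_smul, Real.norm_eq_abs, abs_abs, Real.norm_eq_abs]

/-- A seminorm in `y` which, when the norm is order continuous, is the norm of the component of `y`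
in the band generated by `u`. The supremum over the truncations `|y| ⊓ k • |u|` replaces the band
projection, which need not exist in general. -/
noncomputable def bandSeminorm (u : E) : Seminorm ℝ E :=
  Seminorm.ofSMulLE (fun y => ⨆ k : ℕ, ‖|y| ⊓ k • |u|‖)
    (by simp [abs_nonneg, nsmul_nonneg])
    (fun y z => ciSup_le fun k =>
      (norm_abs_add_inf_le (nsmul_nonneg (abs_nonneg u) k) y z).trans (add_le_add
        (le_ciSup (bddAbove_range_norm_abs_inf_nsmul_abs u y) k)
        (le_ciSup (bddAbove_range_norm_abs_inf_nsmul_abs u z) k)))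
    (fun r y => ciSup_le fun k => by
      rcases eq_or_ne r 0 with rfl | hr
      · simp [abs_nonneg, nsmul_nonneg]
      obtain ⟨m, hm⟩ := exists_norm_abs_smul_inf_nsmul_le u hr y k
      exact hm.trans (mul_le_mul_of_nonneg_left
        (le_ciSup (bddAbove_range_norm_abs_inf_nsmul_abs u y) m) (norm_nonneg r)))

theorem bandSeminorm_apply (u y : E) : bandSeminorm u y = ⨆ k : ℕ, ‖|y| ⊓ k • |u|‖ := rfl

theorem bandSeminorm_le_norm (u y : E) : bandSeminorm u y ≤ ‖y‖ :=
  ciSup_le (norm_abs_inf_nsmul_abs_le u y)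

theorem continuous_bandSeminorm (u : E) : Continuous (bandSeminorm u) :=
  Seminorm.continuous_of_le (q := normSeminorm ℝ E) continuous_norm (bandSeminorm_le_norm u)

theorem bandSeminorm_self (u : E) : bandSeminorm u u = ‖u‖ := by
  refine le_antisymm (bandSeminorm_le_norm u u) ?_
  simpa [bandSeminorm_apply, norm_abs_eq_norm] using
    le_ciSup (bddAbove_range_norm_abs_inf_nsmul_abs u u) 1

theorem HasNullOrderBoundedDisjointSeqs.tendsto_bandSeminorm
    (hE : HasNullOrderBoundedDisjointSeqs E) {x : ℕ → E} (hx : IsDisjointSeq x) (y : E) :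
    Tendsto (fun n => bandSeminorm (x n) y) atTop (𝓝 0) := by
  have happrox : ∀ n : ℕ, ∃ k : ℕ, bandSeminorm (x n) y - 1 / (n + 1) < ‖|y| ⊓ k • |x n|‖ :=
    fun n => exists_lt_of_lt_ciSup (sub_lt_self _ Nat.one_div_pos_of_nat)
  choose k hk using happrox
  have habs : ∀ n, |(|y| ⊓ k n • |x n|)| = |y| ⊓ k n • |x n| := fun n =>
    abs_of_nonneg (le_inf (abs_nonneg y) (nsmul_nonneg (abs_nonneg _) _))
  have hdisj : IsDisjointSeq fun n => |y| ⊓ k n • |x n| :=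
    hx.of_abs_le_nsmul_abs fun n => (habs n).trans_le inf_le_right
  have hnull := hE _ |y| hdisj fun n => (habs n).trans_le inf_le_left
  refine squeeze_zero (fun n => apply_nonneg _ _) (fun n => (sub_lt_iff_lt_add.1 (hk n)).le) ?_
  simpa using hnull.norm.add (tendsto_one_div_add_atTop_nhds_zero_nat (𝕜 := ℝ))

theorem IsDisjointSeq.tendsto_zero_of_isLimitedSet_range (hE : HasNullOrderBoundedDisjointSeqs E)
    {x : ℕ → E} (hx : IsDisjointSeq x) (hlim : IsLimitedSet (Set.range x)) :
    Tendsto x atTop (𝓝 0) := by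
  choose f hfx hf using fun n => exists_strongDual_eq_seminorm (continuous_bandSeminorm (x n)) (x n)
  have hnull : Tendsto (fun n => StrongDual.toWeakDual (f n)) atTop (𝓝 0) :=
    tendsto_iff_forall_eval_tendsto_topDualPairing.2 fun y =>
      squeeze_zero_norm (fun n => hf n y) (hE.tendsto_bandSeminorm hx y)
  have hdiag : ∀ n, f n (x n) = ‖x n‖ := fun n => (hfx n).trans (bandSeminorm_self (x n))
  rw [tendsto_zero_iff_norm_tendsto_zero, Metric.tendsto_nhds]
  intro ε hε
  filter_upwards [Metric.tendstoUniformlyOn_iff.1 (hlim _ hnull) ε hε] with n hn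
  rw [dist_comm, ← hdiag]
  exact hn (x n) ⟨n, rfl⟩

end BandSeminorm

theorem proposition3p6 {E : Type*} [NormedAddCommGroup E] [NormedSpace ℝ E] [CompleteSpace E]
    [Lattice E] [IsOrderedAddMonoid E] [IsOrderedModule ℝ E] [HasSolidNorm E]
    (p : ℝ) (hp : 1 ≤ p) :
    HasPositiveSchurProperty p E ↔
      HasOrderContinuousNorm E ∧ HasDisjointDPStarProperty p E := by
  constructor
  · intro hS
    exact ⟨(hS.hasNullOrderBoundedDisjointSeqs hp).hasOrderContinuousNorm,
      fun x hx hxp => isLimitedSet_range_of_tendsto (hS x hx hxp)⟩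
  · rintro ⟨hOC, hDP⟩ x hx hxp
    exact hx.tendsto_zero_of_isLimitedSet_range hOC.hasNullOrderBoundedDisjointSeqs (hDP x hx hxp)
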